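/- Let $\varphi=(1+\sqrt5)/2$. Define an infinite array $A[n,k]$ ($n,k\ge 0$) as follows. Row $0$ is $0,1,2,\ldots$, that is, $A[0,k]=k$. For $n\ge 1$, row $n$ is created from row $n-1$ by finding the unique occurrence of the entry $n$ in row $n-1$ and shifting it by $n$ positions to the right (so that each of the $n$ entries it jumps over moves one position to the left, and all other entries stay in place); each row is a permutation of $\{0,1,2,\ldots\}$. For $n\ge1$ let $p(n)$ be the position of $n$ in row $n-1$, i.e. the unique $i$ with $A[n-1,i]=n$, and let $s(n)=A[n-1,p(n)+1]$ be the first of the $n$ entries that $n$ jumps over. Then no integer appears three or more times in the sequence $(s(n))_{n\ge1}$. Furthermore, an integer $m$ appears exactly twice in $(s(n))_{n\ge1}$ if and only if there exists an integer $k\ge1$ such that $m=\lfloor k\varphi^2\rfloor$ (that is, $m$ belongs to the sequence A001950 of the OEIS). -/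

import Mathlib

namespace HurtSada

/-- The position of the entry `m` in the row `r` (its least index; every row of the array below is
a permutation of `ℕ`, see `array_bijective`, so there is exactly one such index). -/
noncomputable def position (r : ℕ → ℕ) (m : ℕ) : ℕ := sInf {i | r i = m}

/-- The row obtained from the row `r` by shifting the entry in position `i` by `m` positions to the
right; the `m` entries it jumps over each move one position to the left. -/
def shiftRight (r : ℕ → ℕ) (i m : ℕ) : ℕ → ℕ := fun j =>
  if j < i then r j
  else if j < i + m then r (j + 1)
  else if j = i + m then r i
  else r j

/-- The Hurt-Sada array `A`: `array n k` is the entry in row `n` and column `k`. Row `0` is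
`0, 1, 2, …`, and row `n + 1` is created from row `n` by shifting the entry `n + 1` by `n + 1`
positions to the right. -/
noncomputable def array : ℕ → ℕ → ℕ
  | 0 => fun k => k
  | n + 1 => shiftRight (array n) (position (array n) (n + 1)) (n + 1)

/-- `p n`, for `n ≥ 1`, is the position of `n` in row `n - 1` of the array. -/
noncomputable def p (n : ℕ) : ℕ := position (array (n - 1)) n

/-- Sada's sequence: `s n`, for `n ≥ 1`, is the first of the `n` elements that `n` jumps over when
row `n` is created from row `n - 1`. -/
noncomputable def s (n : ℕ) : ℕ := array (n - 1) (p n + 1)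

theorem shiftRight_bijective {r : ℕ → ℕ} (hr : Function.Bijective r) (i m : ℕ) :
    Function.Bijective (shiftRight r i m) := by
  have h : shiftRight r i m = r ∘ shiftRight id i m := by
    funext j
    simp only [shiftRight, Function.comp, id]
    split_ifs <;> rfl
  rw [h]
  refine hr.comp ⟨fun a b hab => ?_, fun b => ?_⟩
  · simp only [shiftRight, id] at hab
    split_ifs at hab <;> omega
  · by_cases h1 : b < i
    · exact ⟨b, by simp [shiftRight, h1]⟩
    · by_cases h2 : b = i
      · exact ⟨i + m, by simp [shiftRight, h2]⟩
      · by_cases h3 : b ≤ i + m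
        · refine ⟨b - 1, ?_⟩
          simp only [shiftRight, id]
          split_ifs <;> omega
        · refine ⟨b, ?_⟩
          simp only [shiftRight, id]
          split_ifs <;> omega

/-- Each row of the array is a permutation of `ℕ`. -/
theorem array_bijective (n : ℕ) : Function.Bijective (array n) := by
  induction n with
  | zero => exact Function.bijective_id
  | succ n ih => exact shiftRight_bijective ih _ _

/-- The entry `m` does stand at its position, and nowhere else. -/
theorem array_eq_iff (n m i : ℕ) : array n i = m ↔ i = position (array n) m := by
  have h : array n (position (array n) m) = m :=
    Nat.sInf_mem (s := {i | array n i = m}) ((array_bijective n).2 m)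
  exact ⟨fun hi => (array_bijective n).1 (hi.trans h.symm), fun hi => hi ▸ h⟩

end HurtSada

/-! Write L(n) = ⌊nφ⌋ and U(n) = L(n) + n. Every row has a closed form (`RowSpec`): inside a finite
window of row n, column i holds v when the label i + n + 2 is L(v+1) or U(v+1). So n+1 stands at
label L(n+2), and s(n+1) is read off at label L(n+2) + 1. That label is L(n+3) after a gap of one,
giving s(n+1) = n+2; after a gap of two it is an upper Wythoff number, giving s(n+1) = L(n+2) - n -
2. Inverting (`s_eq_iff`), each m ≥ 1 arises from n = L(m+1) - 1, and also from n = m - 1 exactly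
when L(m+1) = L(m) + 1, which means that m is some U(k) (`lowerWythoff_succ_eq_iff`). -/

namespace HurtSada

open Real

/-! ### Wythoff sequences -/

/-- The lower Wythoff sequence `⌊n φ⌋`. -/
noncomputable def lowerWythoff (n : ℕ) : ℕ := ⌊(n : ℝ) * goldenRatio⌋₊

theorem lowerWythoff_lt {n : ℕ} (hn : 1 ≤ n) : (lowerWythoff n : ℝ) < n * goldenRatio := by
  refine lt_of_le_of_ne (Nat.floor_le (by positivity)) fun h => ?_
  exact (goldenRatio_irrational.natCast_mul (by omega : n ≠ 0)).ne_nat _ h.symm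

theorem lt_lowerWythoff_add_one (n : ℕ) : (n : ℝ) * goldenRatio < lowerWythoff n + 1 :=
  Nat.lt_floor_add_one _

theorem lowerWythoff_eq {n c : ℕ} (h₁ : (c : ℝ) ≤ n * goldenRatio)
    (h₂ : (n : ℝ) * goldenRatio < c + 1) : lowerWythoff n = c :=
  (Nat.floor_eq_iff (by positivity)).2 ⟨h₁, h₂⟩

theorem goldenRatio_bounds : (1.6 : ℝ) < goldenRatio ∧ goldenRatio < 1.65 := by
  have h := goldenRatio_sq
  have h1 := one_lt_goldenRatio
  constructor <;> nlinarith

theorem lowerWythoff_one : lowerWythoff 1 = 1 := by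
  have h := goldenRatio_bounds
  apply lowerWythoff_eq <;> norm_num <;> linarith [h.1, h.2]

theorem lowerWythoff_two : lowerWythoff 2 = 3 := by
  have h := goldenRatio_bounds
  apply lowerWythoff_eq <;> norm_num <;> linarith [h.1, h.2]

theorem lowerWythoff_three : lowerWythoff 3 = 4 := by
  have h := goldenRatio_bounds
  apply lowerWythoff_eq <;> norm_num <;> linarith [h.1, h.2]

theorem lowerWythoff_succ (n : ℕ) :
    lowerWythoff (n + 1) = lowerWythoff n + 1 ∨ lowerWythoff (n + 1) = lowerWythoff n + 2 := by
  have h := goldenRatio_bounds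
  have h₁ : (lowerWythoff n : ℝ) ≤ n * goldenRatio := Nat.floor_le (by positivity)
  have h₂ := lt_lowerWythoff_add_one n
  have h₃ := lowerWythoff_lt (n := n + 1) (by omega)
  have h₄ := lt_lowerWythoff_add_one (n + 1)
  push_cast at h₃ h₄
  have h₅ : lowerWythoff (n + 1) < lowerWythoff n + 3 := by
    exact_mod_cast (by linarith [h.2] : (lowerWythoff (n + 1) : ℝ) < lowerWythoff n + 3)
  have h₆ : lowerWythoff n < lowerWythoff (n + 1) := by
    exact_mod_cast (by linarith [h.1] : (lowerWythoff n : ℝ) < lowerWythoff (n + 1))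
  omega

theorem lowerWythoff_strictMono : StrictMono lowerWythoff :=
  strictMono_nat_of_lt_succ fun n => by have := lowerWythoff_succ n; omega

theorem lt_lowerWythoff_succ (n : ℕ) : n < lowerWythoff (n + 1) := by
  induction n with
  | zero => simp [lowerWythoff_one]
  | succ n ih => have := lowerWythoff_succ (n + 1); omega

/-- The lower and upper Wythoff sequences are disjoint. -/
theorem lowerWythoff_ne_upper {x y : ℕ} (hx : 1 ≤ x) (hy : 1 ≤ y) :
    lowerWythoff x ≠ lowerWythoff y + y := by
  intro h
  have hg := goldenRatio_bounds
  have hs := goldenRatio_sq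
  have h₁ := lowerWythoff_lt hx
  have h₂ := lt_lowerWythoff_add_one x
  have h₃ := lowerWythoff_lt hy
  have h₄ := lt_lowerWythoff_add_one y
  have hc : (lowerWythoff x : ℝ) = lowerWythoff y + y := by exact_mod_cast h
  -- Beatty's argument: a common value c has c < xφ < c+1 and c < yφ² < c+1. As 1/φ + 1/φ² = 1, this
  -- puts x + y strictly between c and c+1.
  have e : ((x : ℝ) + y) * goldenRatio ^ 2
      = (x * goldenRatio) * goldenRatio + (y * goldenRatio + y) := by linear_combination (y : ℝ) * hs
  have l : (lowerWythoff x : ℝ) * goldenRatio ^ 2 < ((x : ℝ) + y) * goldenRatio ^ 2 := by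
    rw [e]; nlinarith
  have u : ((x : ℝ) + y) * goldenRatio ^ 2 < ((lowerWythoff x : ℝ) + 1) * goldenRatio ^ 2 := by
    rw [e]; nlinarith
  have l' := lt_of_mul_lt_mul_right l (by positivity)
  have u' := lt_of_mul_lt_mul_right u (by positivity)
  have l'' : lowerWythoff x < x + y := by exact_mod_cast l'
  have u'' : x + y < lowerWythoff x + 1 := by exact_mod_cast u'
  omega

/-- A number skipped by the lower Wythoff sequence is a term of the upper one. -/
theorem upper_of_lowerWythoff_gap {n : ℕ} (h : lowerWythoff (n + 1) = lowerWythoff n + 2)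
    {k : ℕ} (hk : k + n = lowerWythoff n + 1) : lowerWythoff k + k = lowerWythoff n + 1 := by
  have hg := goldenRatio_bounds
  have hs := goldenRatio_sq
  have h₁ : (lowerWythoff n : ℝ) ≤ n * goldenRatio := Nat.floor_le (by positivity)
  have h₂ := lt_lowerWythoff_add_one n
  have h₃ := lowerWythoff_lt (n := n + 1) (by omega)
  rw [h] at h₃
  push_cast at h₃
  have hk' : (k : ℝ) = lowerWythoff n + 1 - n := by
    have : (k : ℝ) + n = lowerWythoff n + 1 := by exact_mod_cast hk
    linarith
  have e : (k : ℝ) * goldenRatio = lowerWythoff n * goldenRatio + goldenRatio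
      - n * goldenRatio := by rw [hk']; ring
  have hkn : lowerWythoff k = n := by
    apply lowerWythoff_eq
    · nlinarith
    · nlinarith
  omega

/-- Between consecutive terms `⌊n φ⌋ < t ≤ ⌊(n + 1) φ⌋` the lower Wythoff sequence is `t + n`. -/
theorem lowerWythoff_between {n t : ℕ} (h₁ : lowerWythoff n < t)
    (h₂ : t ≤ lowerWythoff (n + 1)) : lowerWythoff t = t + n := by
  have hg := goldenRatio_bounds
  have hs := goldenRatio_sq
  have a₁ := lt_lowerWythoff_add_one n
  have a₂ := lowerWythoff_lt (n := n + 1) (by omega)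
  have b₁ : (lowerWythoff n : ℝ) + 1 ≤ t := by exact_mod_cast h₁
  have b₂ : (t : ℝ) ≤ lowerWythoff (n + 1) := by exact_mod_cast h₂
  push_cast at a₂
  -- Multiplying nφ < t < (n+1)φ by φ - 1 = 1/φ gives n < tφ - t < n+1.
  have e : goldenRatio * (goldenRatio - 1) = 1 := by linarith
  apply lowerWythoff_eq
  · push_cast
    nlinarith [mul_lt_mul_of_pos_right (lt_of_lt_of_le a₁ b₁) (by linarith : 0 < goldenRatio - 1)]
  · push_cast
    nlinarith [mul_lt_mul_of_pos_right (lt_of_le_of_lt b₂ a₂) (by linarith : 0 < goldenRatio - 1)]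

theorem floor_mul_goldenRatio_sq (k : ℕ) :
    ⌊(k : ℝ) * goldenRatio ^ 2⌋ = ((lowerWythoff k + k : ℕ) : ℤ) := by
  have h₁ : (lowerWythoff k : ℝ) ≤ k * goldenRatio := Nat.floor_le (by positivity)
  have h₂ := lt_lowerWythoff_add_one k
  rw [Int.floor_eq_iff, goldenRatio_sq]
  push_cast
  constructor <;> linarith

/-- The gap of the lower Wythoff sequence after `m` is `1` exactly when `m` is an upper Wythoff
number. -/
theorem lowerWythoff_succ_eq_iff {m : ℕ} (hm : 1 ≤ m) :
    lowerWythoff (m + 1) = lowerWythoff m + 1 ↔ ∃ k, 1 ≤ k ∧ m = lowerWythoff k + k := by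
  constructor
  · intro h
    have hlt := lowerWythoff_lt hm
    have hub := lt_lowerWythoff_add_one (m + 1)
    have hub' := lt_lowerWythoff_add_one m
    have hg := goldenRatio_bounds
    have hs := goldenRatio_sq
    rw [h] at hub
    push_cast at hub
    have hm' : (1 : ℝ) ≤ m := by exact_mod_cast hm
    have hle : lowerWythoff m < 2 * m := by
      exact_mod_cast (by nlinarith : (lowerWythoff m : ℝ) < 2 * m)
    have hge : m ≤ lowerWythoff m := by
      have := lt_lowerWythoff_succ (m - 1)
      rw [Nat.sub_add_cancel hm] at this
      omega
    -- The index is the ceiling of m/φ² = 2m - mφ.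
    refine ⟨2 * m - lowerWythoff m, by omega, ?_⟩
    have hk : ((2 * m - lowerWythoff m : ℕ) : ℝ) = 2 * m - lowerWythoff m := by
      rw [Nat.cast_sub hle.le]; push_cast; ring
    have hw : lowerWythoff (2 * m - lowerWythoff m) = lowerWythoff m - m := by
      apply lowerWythoff_eq
      · rw [hk, Nat.cast_sub hge]; nlinarith
      · rw [hk, Nat.cast_sub hge]; nlinarith
    omega
  · rintro ⟨k, hk, rfl⟩
    rcases lowerWythoff_succ (lowerWythoff k + k) with h | h
    · exact h
    · exfalso
      have h₁ := lowerWythoff_lt hk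
      have h₂ := lowerWythoff_lt (n := lowerWythoff k + k + 1) (by omega)
      have h₃ := lt_lowerWythoff_add_one k
      have h₄ := lt_lowerWythoff_add_one (lowerWythoff k + k)
      have hg := goldenRatio_bounds
      have hs := goldenRatio_sq
      rw [h] at h₂
      push_cast at h₂ h₄
      -- With δ = kφ - L(k) in (0,1), U(k)φ = 2L(k) + k + δ(2 - φ). Adding φ stays below 2L(k) + k +
      -- 2, so the gap cannot be two.
      have hA : 2 * lowerWythoff k + k ≤ lowerWythoff (lowerWythoff k + k) := by
        apply Nat.le_floor
        push_cast
        nlinarith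
      have hA' : (2 * lowerWythoff k + k : ℝ) ≤ lowerWythoff (lowerWythoff k + k) := by
        exact_mod_cast hA
      nlinarith

/-! ### Closed form of the rows -/

/-- Row `n` of the array: the identity outside of `[⌊(n+1) φ⌋ - n - 1, ⌊(n+1) φ⌋)`, and inside of
that interval the entry in column `i` is the index, less one, of `i + n + 2` in the lower or the
upper Wythoff sequence. -/
structure RowSpec (n : ℕ) (r : ℕ → ℕ) : Prop where
  left : ∀ i, i + n + 1 < lowerWythoff (n + 1) → r i = i
  lower : ∀ i v, lowerWythoff (n + 1) ≤ i + n + 1 → i < lowerWythoff (n + 1) →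
    i + n + 2 = lowerWythoff (v + 1) → r i = v
  upper : ∀ i v, lowerWythoff (n + 1) ≤ i + n + 1 → i < lowerWythoff (n + 1) →
    i + n + 2 = lowerWythoff (v + 1) + (v + 1) → r i = v
  right : ∀ i, lowerWythoff (n + 1) ≤ i → r i = i

theorem upper_injective {u v : ℕ} (h : lowerWythoff u + u = lowerWythoff v + v) : u = v := by
  rcases lt_trichotomy u v with h' | h' | h'
  · have := lowerWythoff_strictMono h'; omega
  · exact h'
  · have := lowerWythoff_strictMono h'; omega

theorem RowSpec.zero : RowSpec 0 fun k => k where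
  left _ _ := rfl
  lower i v h₁ h₂ h₃ := by
    simp only [zero_add, lowerWythoff_one] at h₁ h₂
    have hi : i = 0 := by omega
    subst hi
    refine (lowerWythoff_ne_upper (x := v + 1) (y := 1) (by omega) le_rfl ?_).elim
    rw [← h₃, lowerWythoff_one]
  upper i v h₁ h₂ h₃ := by
    simp only [zero_add, lowerWythoff_one] at h₁ h₂
    have := lt_lowerWythoff_succ v
    omega
  right _ _ := rfl

/-- The column of `n + 1` in row `n`. -/
theorem RowSpec.apply_next {n : ℕ} {r : ℕ → ℕ} (h : RowSpec n r) {i : ℕ}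
    (hi : i + n + 2 = lowerWythoff (n + 2)) : r i = n + 1 := by
  have hd : lowerWythoff (n + 2) = lowerWythoff (n + 1) + 1 ∨
    lowerWythoff (n + 2) = lowerWythoff (n + 1) + 2 := lowerWythoff_succ (n + 1)
  have hpos : n + 1 < lowerWythoff (n + 2) := lt_lowerWythoff_succ (n + 1)
  have h₁ := lowerWythoff_one
  have h₂ := lowerWythoff_two
  by_cases hlt : i < lowerWythoff (n + 1)
  · exact h.lower i (n + 1) (by omega) hlt hi
  · rw [h.right i (by omega)]
    have hl := lt_lowerWythoff_succ n
    obtain rfl : n = 0 := by omega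
    norm_num at *
    omega

/-- A jumped entry moves one column left while n grows by one, so its label i + n + 2 is unchanged.
Only columns entering or leaving the window, and the landing column of n+1, need an argument. -/
theorem RowSpec.succ {n : ℕ} {r : ℕ → ℕ} (h : RowSpec n r) {i : ℕ}
    (hi : i + n + 2 = lowerWythoff (n + 2)) : RowSpec (n + 1) (shiftRight r i (n + 1)) := by
  have hd : lowerWythoff (n + 2) = lowerWythoff (n + 1) + 1 ∨
    lowerWythoff (n + 2) = lowerWythoff (n + 1) + 2 := lowerWythoff_succ (n + 1)
  have hpos := lt_lowerWythoff_succ n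
  have hri := h.apply_next hi
  -- Entries that join the window from the untouched right part: j + 1 lands in column j, whose
  -- label is L(j+2).
  have hent : ∀ j, lowerWythoff (n + 1) ≤ j + 1 → j + 2 ≤ lowerWythoff (n + 2) →
      lowerWythoff (j + 2) = j + n + 3 := fun j h₁ h₂ => by
    rw [lowerWythoff_between (n := n + 1) (by omega) h₂]; omega
  refine ⟨fun j hj => ?_, fun j v h₁ h₂ h₃ => ?_, fun j v h₁ h₂ h₃ => ?_, fun j hj => ?_⟩ <;>
    simp only [show n + 1 + 1 = n + 2 from rfl] at * <;> unfold shiftRight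
  · rw [if_pos (by omega)]
    by_cases hl : j + n + 1 < lowerWythoff (n + 1)
    · exact h.left j hl
    -- The column dropped from the window after a gap of two: its old label L(n+1) + 1 is U(j+1), so
    -- it already holds j.
    · refine h.upper j j (by omega) (by omega) ?_
      rw [upper_of_lowerWythoff_gap (n := n + 1) (k := j + 1) (by show lowerWythoff (n + 2) = _; omega) (by omega)]
      omega
  · rw [if_neg (by omega)]
    by_cases hj : j < i + (n + 1)
    · rw [if_pos hj]
      by_cases hl : j + 1 < lowerWythoff (n + 1)
      · exact h.lower (j + 1) v (by omega) hl (by omega)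
      · rw [h.right (j + 1) (by omega)]
        have := hent j (by omega) (by omega)
        have := lowerWythoff_strictMono.injective (a₁ := j + 2) (a₂ := v + 1) (by omega)
        omega
    -- The landing column of n+1 has label U(n+2), hence no lower one.
    · exact (lowerWythoff_ne_upper (x := v + 1) (y := n + 2) (by omega) (by omega)
        (by omega)).elim
  · rw [if_neg (by omega)]
    by_cases hj : j < i + (n + 1)
    · rw [if_pos hj]
      by_cases hl : j + 1 < lowerWythoff (n + 1)
      · exact h.upper (j + 1) v (by omega) hl (by omega)
      · have := hent j (by omega) (by omega)
        exact (lowerWythoff_ne_upper (x := j + 2) (y := v + 1) (by omega) (by omega)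
          (by omega)).elim
    · rw [if_neg hj, if_pos (by omega), hri]
      have := upper_injective (u := n + 2) (v := v + 1) (by omega)
      omega
  · rw [if_neg (by omega), if_neg (by omega), if_neg (by omega)]
    exact h.right j (by omega)

theorem position_of_rowSpec {n : ℕ} (h : RowSpec n (array n)) :
    position (array n) (n + 1) + n + 2 = lowerWythoff (n + 2) := by
  have := lt_lowerWythoff_succ (n + 1)
  obtain ⟨i, hi⟩ : ∃ i, i + n + 2 = lowerWythoff (n + 2) :=
    ⟨lowerWythoff (n + 2) - (n + 2), by
      simp only [show n + 1 + 1 = n + 2 from rfl] at this; omega⟩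
  rw [← (array_eq_iff n (n + 1) i).1 (h.apply_next hi), hi]

theorem rowSpec_array (n : ℕ) : RowSpec n (array n) := by
  induction n with
  | zero => exact RowSpec.zero
  | succ n ih => exact ih.succ (position_of_rowSpec ih)

/-! ### Values of s and their preimages -/

/-- If the lower Wythoff sequence has a gap of one after index `n + 2`, then `s (n + 1) = n + 2`. -/
theorem s_succ_of_gap_one (n : ℕ) (h : lowerWythoff (n + 3) = lowerWythoff (n + 2) + 1) :
    s (n + 1) = n + 2 := by
  have hp := position_of_rowSpec (rowSpec_array n)
  have hr := rowSpec_array n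
  have hd : lowerWythoff (n + 2) = lowerWythoff (n + 1) + 1 ∨
    lowerWythoff (n + 2) = lowerWythoff (n + 1) + 2 := lowerWythoff_succ (n + 1)
  unfold s p
  simp only [Nat.add_sub_cancel]
  by_cases hl : position (array n) (n + 1) + 1 < lowerWythoff (n + 1)
  · refine hr.lower _ (n + 2) (by omega) hl ?_
    show _ = lowerWythoff (n + 3)
    omega
  · rw [hr.right _ (by omega)]
    have h1 := lowerWythoff_one
    have h2 := lowerWythoff_two
    have h3 := lowerWythoff_three
    have hn : n = 0 ∨ n = 1 := by omega
    rcases hn with rfl | rfl <;> norm_num at * <;> omega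

/-- If the lower Wythoff sequence has a gap of two after index `n + 2`, then `s (n + 1)` is the
column of `n + 1`. -/
theorem s_succ_of_gap_two (n : ℕ) (h : lowerWythoff (n + 3) = lowerWythoff (n + 2) + 2) :
    s (n + 1) + n + 2 = lowerWythoff (n + 2) := by
  have hp := position_of_rowSpec (rowSpec_array n)
  have hr := rowSpec_array n
  have hd : lowerWythoff (n + 2) = lowerWythoff (n + 1) + 1 ∨
    lowerWythoff (n + 2) = lowerWythoff (n + 1) + 2 := lowerWythoff_succ (n + 1)
  have h1 := lowerWythoff_one
  have h2 := lowerWythoff_two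
  have h3 := lowerWythoff_three
  have hs : s (n + 1) = position (array n) (n + 1) := by
    unfold s p
    simp only [Nat.add_sub_cancel]
    by_cases hl : position (array n) (n + 1) + 1 < lowerWythoff (n + 1)
    · refine hr.upper _ _ (by omega) hl ?_
      rw [upper_of_lowerWythoff_gap (n := n + 2) (k := position (array n) (n + 1) + 1) h
        (by omega)]
      omega
    · have hn : n = 0 ∨ n = 1 := by omega
      rcases hn with rfl | rfl <;> norm_num at * <;> omega
  omega

/-- The gap of the lower Wythoff sequence after index `n` is two, with `m = ⌊n φ⌋ - n`, exactly for
`n = ⌊(m + 1) φ⌋`. -/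
theorem gap_two_iff (n m : ℕ) :
    (lowerWythoff (n + 1) = lowerWythoff n + 2 ∧ m + n = lowerWythoff n) ↔
      lowerWythoff (m + 1) = n := by
  constructor
  · rintro ⟨h, hm⟩
    have := upper_of_lowerWythoff_gap h (k := m + 1) (by omega)
    omega
  · intro h
    rcases lowerWythoff_succ m with hm | hm
    all_goals
      -- As n = L(m+1) closes one block and n+1 opens the next, L(n) = n + m and L(n+1) = n + m + 2.
      have hb := lowerWythoff_between (n := m) (t := n) (by omega) (by omega)
      have hb' := lowerWythoff_between (n := m + 1) (t := n + 1) (by omega) (by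
        have := lowerWythoff_strictMono (show m + 1 < m + 1 + 1 by omega); omega)
      omega

/-- The solutions of `s n = m`. -/
theorem s_eq_iff {n : ℕ} (hn : 1 ≤ n) (m : ℕ) :
    s n = m ↔ (lowerWythoff (m + 1) = lowerWythoff m + 1 ∧ n + 1 = m) ∨
      n + 1 = lowerWythoff (m + 1) := by
  obtain ⟨n, rfl⟩ : ∃ k, n = k + 1 := ⟨n - 1, by omega⟩
  have hg := gap_two_iff (n + 2) m
  simp only [show n + 1 + 1 = n + 2 from rfl]
  rcases lowerWythoff_succ (n + 2) with h | h
  · rw [s_succ_of_gap_one n h]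
    constructor
    · rintro rfl
      exact Or.inl ⟨h, rfl⟩
    · rintro (h' | h')
      · exact h'.2
      · have := h.symm.trans (hg.2 h'.symm).1
        omega
  · have hs := s_succ_of_gap_two n h
    constructor
    · rintro rfl
      exact Or.inr (hg.1 ⟨h, by omega⟩).symm
    · rintro (⟨h', rfl⟩ | h')
      · have := h.symm.trans h'
        omega
      · have := (hg.2 h'.symm).2
        omega

/-! ### Counting occurrences -/

theorem setOf_s_eq_of_gap_one {m : ℕ} (hm : 1 ≤ m)
    (h : lowerWythoff (m + 1) = lowerWythoff m + 1) :
    {n : ℕ | 1 ≤ n ∧ (s n : ℤ) = m} = {m - 1, lowerWythoff (m + 1) - 1} := by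
  -- Needed so that the solution n = m - 1 is at least 1.
  have hm2 : 2 ≤ m := by
    by_contra hlt
    have : m = 1 := by omega
    subst this
    norm_num [lowerWythoff_one, lowerWythoff_two] at h
  have hl := lt_lowerWythoff_succ m
  ext n
  simp only [Set.mem_ofPred_eq, Set.mem_insert_iff, Set.mem_singleton_iff, Nat.cast_inj]
  constructor
  · rintro ⟨hn, hs⟩
    rcases (s_eq_iff hn m).1 hs with h' | h' <;> omega
  · intro hn
    have hn1 : 1 ≤ n := by omega
    refine ⟨hn1, (s_eq_iff hn1 m).2 ?_⟩
    rcases hn with hn | hn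
    · exact Or.inl ⟨h, by omega⟩
    · exact Or.inr (by omega)

theorem setOf_s_eq_subset_of_not_gap_one {m : ℕ}
    (h : lowerWythoff (m + 1) ≠ lowerWythoff m + 1) :
    {n : ℕ | 1 ≤ n ∧ (s n : ℤ) = m} ⊆ {lowerWythoff (m + 1) - 1} := by
  rintro n ⟨hn, hs⟩
  rcases (s_eq_iff hn m).1 (by exact_mod_cast hs) with h' | h'
  · exact absurd h'.1 h
  · simp only [Set.mem_singleton_iff]; omega

theorem setOf_s_eq_zero : {n : ℕ | 1 ≤ n ∧ (s n : ℤ) = (0 : ℕ)} = ∅ := by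
  ext n
  simp only [Set.mem_ofPred_eq, Nat.cast_inj, Set.mem_empty_iff_false, iff_false]
  rintro ⟨hn, hs⟩
  have := (s_eq_iff hn 0).1 hs
  have := lowerWythoff_one
  norm_num at *
  omega

/-- The number of occurrences of `m` in Sada's sequence. -/
theorem encard_setOf_s_eq (m : ℤ) :
    {n : ℕ | 1 ≤ n ∧ (s n : ℤ) = m}.encard = 2 ∧
        (∃ k : ℕ, 1 ≤ k ∧ m = ⌊(k : ℝ) * goldenRatio ^ 2⌋) ∨
      {n : ℕ | 1 ≤ n ∧ (s n : ℤ) = m}.encard ≤ 1 ∧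
        ¬ ∃ k : ℕ, 1 ≤ k ∧ m = ⌊(k : ℝ) * goldenRatio ^ 2⌋ := by
  simp only [floor_mul_goldenRatio_sq]
  rcases lt_or_ge m 0 with hneg | hm
  · right
    constructor
    · rw [Set.encard_le_one_iff]
      rintro a b ⟨-, ha⟩
      omega
    · rintro ⟨k, -, hk⟩
      omega
  lift m to ℕ using hm
  simp only [Nat.cast_inj (R := ℤ) (m := m)]
  rcases Nat.eq_zero_or_pos m with rfl | hm
  · right
    rw [setOf_s_eq_zero]
    refine ⟨by simp, ?_⟩
    rintro ⟨k, hk, hk'⟩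
    omega
  · rw [← lowerWythoff_succ_eq_iff hm]
    by_cases h : lowerWythoff (m + 1) = lowerWythoff m + 1
    · left
      have hl := lt_lowerWythoff_succ m
      refine ⟨?_, h⟩
      rw [setOf_s_eq_of_gap_one hm h]
      exact Set.encard_pair (by omega)
    · exact Or.inr ⟨(Set.encard_le_encard (setOf_s_eq_subset_of_not_gap_one h)).trans
        (Set.encard_singleton _).le, h⟩

end HurtSada

/-- In Sada's sequence `(s n)_{n ≥ 1}` no integer occurs three or more times, and an integer occurs
exactly twice if and only if it is `⌊k φ²⌋` for some `k ≥ 1`. -/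
theorem theorem6 :
    (∀ m : ℤ, ¬ 3 ≤ {n : ℕ | 1 ≤ n ∧ (HurtSada.s n : ℤ) = m}.encard) ∧
    (∀ m : ℤ, {n : ℕ | 1 ≤ n ∧ (HurtSada.s n : ℤ) = m}.encard = 2 ↔
      ∃ k : ℕ, 1 ≤ k ∧ m = ⌊(k : ℝ) * Real.goldenRatio ^ 2⌋) := by
  refine ⟨fun m h => ?_, fun m => ?_⟩
  · rcases HurtSada.encard_setOf_s_eq m with h' | h'
    · rw [h'.1] at h
      exact absurd h (by decide)
    · exact absurd (h.trans h'.1) (by decide)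
  · rcases HurtSada.encard_setOf_s_eq m with h' | h'
    · exact iff_of_true h'.1 h'.2
    · refine iff_of_false (fun h => ?_) h'.2
      rw [h] at h'
      exact absurd h'.1 (by decide)
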